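/- Let $n\ge 1$ and let $B$ be a Hermitian complex $n\times n$ matrix with eigenvalues $b_1,\dots,b_n$ (counted with multiplicity, in any order), exactly $r$ of which are positive. Let $f(x)=|x|$ and let $L$ be the Loewner matrix of $f$ at $B$, i.e. the $n\times n$ matrix with $$L_{ij}=\frac{f(b_i)-f(b_j)}{b_i-b_j}\ \text{ if } b_i\ne b_j,\qquad L_{ij}=f'(b_i)\ \text{ if } b_i=b_j,$$ where $f'(0)$ is taken to be the left derivative $-1$ (this matters only if $B$ is singular). Let $S_L\colon A\mapsto L\circ A$, $(L\circ A)_{ij}=L_{ij}A_{ij}$, be the Schur multiplier operator on complex $n\times n$ matrices, and let $\|S_L\|=\sup_{A\ne0}\|L\circ A\|/\|A\|$ be its norm induced by the operator (spectral) norm. Let $\phi=(1+\sqrt5)/2$. If $1\le r<n$, then $$\|S_L\|\le 3+2\phi^{-1}\min(r,n-r).$$ If $r=0$ or $r=n$, then $\|S_L\|=1$. -/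

import Mathlib

open scoped Matrix Matrix.Norms.L2Operator

noncomputable section

/-- The left derivative of a real function. It is the derivative `f'(x)` wherever `f` is
differentiable (`leftDeriv_eq`). For `f = |·|` the only point where the choice matters is `0`, with
value `-1` there (`leftDeriv_abs_zero`). -/
def leftDeriv (f : ℝ → ℝ) (x : ℝ) : ℝ := derivWithin f (Set.Iic x) x

theorem leftDeriv_eq {f : ℝ → ℝ} {x : ℝ} (h : DifferentiableAt ℝ f x) :
    leftDeriv f x = deriv f x :=
  h.derivWithin (uniqueDiffOn_Iic x x Set.self_mem_Iic)

theorem leftDeriv_abs_zero : leftDeriv (fun x : ℝ => |x|) 0 = -1 := by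
  have h : HasDerivWithinAt (fun x : ℝ => |x|) (-1) (Set.Iic 0) 0 :=
    ((hasDerivAt_id (0 : ℝ)).neg.hasDerivWithinAt).congr
      (fun x hx => abs_of_nonpos (Set.mem_Iic.1 hx)) (by simp)
  exact h.derivWithin (uniqueDiffOn_Iic (0 : ℝ) 0 Set.self_mem_Iic)

/-- The Loewner matrix of `f` at the points `b i`: divided differences where `b i ≠ b j`,
the derivative of `f` where `b i = b j`. -/
def loewnerMatrix (f : ℝ → ℝ) {n : ℕ} (b : Fin n → ℝ) : Matrix (Fin n) (Fin n) ℂ :=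
  Matrix.of fun i j =>
    ((if b i ≠ b j then (f (b i) - f (b j)) / (b i - b j) else leftDeriv f (b i) : ℝ) : ℂ)

/-- The Schur multiplier operator `S_L : A ↦ L ∘ A` (entrywise product) on complex matrices. -/
def schurMultiplier {n : ℕ} (L : Matrix (Fin n) (Fin n) ℂ) :
    Matrix (Fin n) (Fin n) ℂ →ₗ[ℂ] Matrix (Fin n) (Fin n) ℂ where
  toFun A := L ⊙ A
  map_add' A B := Matrix.hadamard_add L A B
  map_smul' c A := Matrix.hadamard_smul L A c

/-- The norm of `S_L` induced by the operator (spectral) norm on complex `n × n` matrices. -/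
def schurMultiplierNorm {n : ℕ} (L : Matrix (Fin n) (Fin n) ℂ) : ℝ :=
  ‖LinearMap.toContinuousLinearMap (schurMultiplier L)‖

/-- The norm of `S_L` is the supremum of the ratios `‖L ∘ A‖ / ‖A‖` in the spectral norm. -/
theorem schurMultiplierNorm_isLUB {n : ℕ} (L : Matrix (Fin n) (Fin n) ℂ) :
    IsLUB (Set.range fun A : Matrix (Fin n) (Fin n) ℂ => ‖L ⊙ A‖ / ‖A‖)
      (schurMultiplierNorm L) := by
  constructor
  · rintro _ ⟨A, rfl⟩
    exact (LinearMap.toContinuousLinearMap (schurMultiplier L)).ratio_le_opNorm A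
  · intro c hc
    refine ContinuousLinearMap.opNorm_le_bound _ ?_ fun A => ?_
    · simpa using hc ⟨0, rfl⟩
    · rcases eq_or_ne A 0 with rfl | hA
      · simp
      · exact (div_le_iff₀ (norm_pos_iff.2 hA)).1 (hc ⟨A, rfl⟩)

end

/-! Let `ε i = ±1` be the sign of `b i`, with 0 counted as negative. Where signs agree, `L i j = ε i
= (ε i + ε j) / 2`; where they differ, this mean is 0 and `|L i j| ≤ 1`. The mean acts by `A ↦ (D A
+ A D) / 2` with `D = diagonal ε`, a contraction. The remainder lives on the mixed blocks, which are
covered by the rows and columns of the smaller sign class, of size `m`. Each row and column of `A`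
has ℓ² norm at most `‖A‖`, so a Frobenius estimate gives `√(2m)`. The resulting `1 + √(2m)` is below
the stated linear bound. -/

open Matrix in
theorem sum_norm_sq_col_le {n : ℕ} (A : Matrix (Fin n) (Fin n) ℂ) (j : Fin n) :
    ∑ i, ‖A i j‖ ^ 2 ≤ ‖A‖ ^ 2 := by
  -- Column `j` is the image of the `j`-th unit vector.
  have h := (toEuclideanCLM (n := Fin n) (𝕜 := ℂ) A).le_opNorm (EuclideanSpace.single j 1)
  rw [l2_opNorm_toEuclideanCLM, PiLp.norm_single, norm_one, mul_one] at h
  have h2 := pow_le_pow_left₀ (norm_nonneg _) h 2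
  simpa [EuclideanSpace.norm_sq_eq] using h2

open Matrix in
theorem sum_norm_sq_row_le {n : ℕ} (A : Matrix (Fin n) (Fin n) ℂ) (i : Fin n) :
    ∑ j, ‖A i j‖ ^ 2 ≤ ‖A‖ ^ 2 := by
  simpa [l2_opNorm_conjTranspose] using sum_norm_sq_col_le Aᴴ i

open Matrix in
/-- The spectral norm is at most the Frobenius norm. -/
theorem l2_opNorm_le_sqrt_sum {n : ℕ} (A : Matrix (Fin n) (Fin n) ℂ) :
    ‖A‖ ≤ √(∑ i, ∑ j, ‖A i j‖ ^ 2) := by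
  rw [← l2_opNorm_toEuclideanCLM]
  refine ContinuousLinearMap.opNorm_le_bound _ (Real.sqrt_nonneg _) fun x => ?_
  refine (sq_le_sq₀ (norm_nonneg _) (by positivity)).1 ?_
  rw [mul_pow, Real.sq_sqrt (by positivity), EuclideanSpace.norm_sq_eq, Finset.sum_mul]
  refine Finset.sum_le_sum fun i _ => ?_
  rw [ofLp_toEuclideanCLM, EuclideanSpace.norm_sq_eq]
  calc ‖(A *ᵥ x) i‖ ^ 2 ≤ (∑ j, ‖A i j‖ * ‖x j‖) ^ 2 := by
        refine pow_le_pow_left₀ (norm_nonneg _) ?_ 2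
        exact (norm_sum_le _ _).trans_eq (Finset.sum_congr rfl fun j _ => norm_mul (A i j) (x j))
    _ ≤ _ := Finset.sum_mul_sq_le_sq_mul_sq _ _ _

/-- A Schur multiplier with entries of modulus at most one, vanishing outside the rows and columns
indexed by `T`, has norm at most `√(2 |T|)`. -/
theorem norm_hadamard_le_sqrt_mul {n : ℕ} (K : Matrix (Fin n) (Fin n) ℂ) (T : Finset (Fin n))
    (hK : ∀ i j, ‖K i j‖ ≤ 1) (hT : ∀ i j, i ∉ T → j ∉ T → K i j = 0)
    (A : Matrix (Fin n) (Fin n) ℂ) :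
    ‖K ⊙ A‖ ≤ √(2 * T.card) * ‖A‖ := by
  refine (l2_opNorm_le_sqrt_sum _).trans ?_
  rw [← Real.sqrt_sq (norm_nonneg A), ← Real.sqrt_mul (by positivity)]
  refine Real.sqrt_le_sqrt ?_
  -- Entries lying in both a row and a column of `T` are counted twice, which is harmless for an
  -- upper bound.
  have hentry : ∀ i j, ‖(K ⊙ A) i j‖ ^ 2 ≤
      (if i ∈ T then ‖A i j‖ ^ 2 else 0) + (if j ∈ T then ‖A i j‖ ^ 2 else 0) := by
    intro i j
    have hle : ‖(K ⊙ A) i j‖ ^ 2 ≤ ‖A i j‖ ^ 2 := by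
      rw [Matrix.hadamard_apply, norm_mul]
      exact pow_le_pow_left₀ (by positivity)
        (mul_le_of_le_one_left (norm_nonneg _) (hK i j)) 2
    by_cases hi : i ∈ T <;> by_cases hj : j ∈ T <;> simp only [hi, hj, if_true, if_false]
    · linarith [sq_nonneg ‖A i j‖]
    · linarith
    · linarith
    · simp [hT i j hi hj]
  have hrow : ∑ i, ∑ j, (if i ∈ T then ‖A i j‖ ^ 2 else 0) ≤ T.card * ‖A‖ ^ 2 := by
    rw [← nsmul_eq_mul, Finset.sum_congr rfl (g := fun i =>
      if i ∈ T then ∑ j, ‖A i j‖ ^ 2 else 0) (fun i _ => by split_ifs <;> simp),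
      Finset.sum_ite_mem, Finset.univ_inter]
    exact Finset.sum_le_card_nsmul _ _ _ fun i _ => sum_norm_sq_row_le A i
  have hcol : ∑ i, ∑ j, (if j ∈ T then ‖A i j‖ ^ 2 else 0) ≤ T.card * ‖A‖ ^ 2 := by
    rw [Finset.sum_comm, ← nsmul_eq_mul, Finset.sum_congr rfl (g := fun j =>
      if j ∈ T then ∑ i, ‖A i j‖ ^ 2 else 0) (fun i _ => by split_ifs <;> simp),
      Finset.sum_ite_mem, Finset.univ_inter]
    exact Finset.sum_le_card_nsmul _ _ _ fun j _ => sum_norm_sq_col_le A j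
  calc _ ≤ ∑ i, ∑ j, ((if i ∈ T then ‖A i j‖ ^ 2 else 0) + (if j ∈ T then ‖A i j‖ ^ 2 else 0)) :=
        Finset.sum_le_sum fun i _ => Finset.sum_le_sum fun j _ => hentry i j
    _ ≤ _ := by
        simp only [Finset.sum_add_distrib]
        linarith

/-- If `ε` has entries of modulus at most one and `L` differs from `(ε i + ε j) / 2` by entries of
modulus at most one, supported on the rows and columns indexed by `T`, then `S_L` has norm at most
`1 + √(2 |T|)`. -/
theorem schurMultiplierNorm_le_one_add_sqrt {n : ℕ} (L : Matrix (Fin n) (Fin n) ℂ) (ε : Fin n → ℂ)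
    (T : Finset (Fin n)) (hε : ∀ i, ‖ε i‖ ≤ 1) (hL : ∀ i j, ‖L i j - (ε i + ε j) / 2‖ ≤ 1)
    (hT : ∀ i j, i ∉ T → j ∉ T → L i j = (ε i + ε j) / 2) :
    schurMultiplierNorm L ≤ 1 + √(2 * T.card) := by
  refine ContinuousLinearMap.opNorm_le_bound _ (by positivity) fun A => ?_
  change ‖L ⊙ A‖ ≤ _
  set K : Matrix (Fin n) (Fin n) ℂ := Matrix.of fun i j => L i j - (ε i + ε j) / 2
  have hsplit : L ⊙ A =
      (2⁻¹ : ℂ) • (Matrix.diagonal ε * A + A * Matrix.diagonal ε) + K ⊙ A := by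
    ext i j
    simp [K, Matrix.hadamard_apply]
    ring
  have hD : ‖(Matrix.diagonal ε : Matrix (Fin n) (Fin n) ℂ)‖ ≤ 1 := by
    rw [Matrix.l2_opNorm_diagonal]
    exact (pi_norm_le_iff_of_nonneg zero_le_one).2 hε
  have h1 : ‖Matrix.diagonal ε * A‖ ≤ ‖A‖ :=
    (norm_mul_le _ _).trans (mul_le_of_le_one_left (norm_nonneg _) hD)
  have h2 : ‖A * Matrix.diagonal ε‖ ≤ ‖A‖ :=
    (norm_mul_le _ _).trans (mul_le_of_le_one_right (norm_nonneg _) hD)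
  have h3 : ‖(2⁻¹ : ℂ) • (Matrix.diagonal ε * A + A * Matrix.diagonal ε)‖ ≤ ‖A‖ := by
    rw [norm_smul, norm_inv, Complex.norm_ofNat]
    linarith [norm_add_le (Matrix.diagonal ε * A) (A * Matrix.diagonal ε)]
  have h4 : ‖K ⊙ A‖ ≤ √(2 * T.card) * ‖A‖ :=
    norm_hadamard_le_sqrt_mul K T hL (fun i j hi hj => sub_eq_zero.2 (hT i j hi hj)) A
  rw [hsplit, add_mul, one_mul]
  exact (norm_add_le _ _).trans (add_le_add h3 h4)

theorem leftDeriv_abs_of_pos {x : ℝ} (hx : 0 < x) : leftDeriv (fun x : ℝ => |x|) x = 1 := by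
  rw [leftDeriv_eq (differentiableAt_abs hx.ne'), deriv_abs_pos hx]

theorem leftDeriv_abs_of_nonpos {x : ℝ} (hx : x ≤ 0) : leftDeriv (fun x : ℝ => |x|) x = -1 := by
  rcases hx.lt_or_eq with h | rfl
  · rw [leftDeriv_eq (differentiableAt_abs h.ne), deriv_abs_neg h]
  · exact leftDeriv_abs_zero

section Abs

variable {n : ℕ} {b : Fin n → ℝ} {i j : Fin n}

theorem loewnerMatrix_abs_of_pos (hi : 0 < b i) (hj : 0 < b j) :
    loewnerMatrix (fun x : ℝ => |x|) b i j = 1 := by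
  simp only [loewnerMatrix, Matrix.of_apply]
  split_ifs with h
  · rw [abs_of_pos hi, abs_of_pos hj, div_self (sub_ne_zero.2 h), Complex.ofReal_one]
  · rw [leftDeriv_abs_of_pos hi, Complex.ofReal_one]

theorem loewnerMatrix_abs_of_nonpos (hi : b i ≤ 0) (hj : b j ≤ 0) :
    loewnerMatrix (fun x : ℝ => |x|) b i j = -1 := by
  simp only [loewnerMatrix, Matrix.of_apply]
  split_ifs with h
  · rw [abs_of_nonpos hi, abs_of_nonpos hj, ← neg_sub', neg_div, div_self (sub_ne_zero.2 h)]
    simp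
  · rw [leftDeriv_abs_of_nonpos hi]
    simp

theorem norm_loewnerMatrix_abs_le_one : ‖loewnerMatrix (fun x : ℝ => |x|) b i j‖ ≤ 1 := by
  by_cases h : b i = b j
  · rcases lt_or_ge 0 (b i) with hi | hi
    · simp [loewnerMatrix_abs_of_pos hi (h ▸ hi)]
    · simp [loewnerMatrix_abs_of_nonpos hi (h ▸ hi)]
  · simp only [loewnerMatrix, Matrix.of_apply, ne_eq, h, not_false_eq_true, if_true,
      Complex.norm_real, Real.norm_eq_abs, abs_div]
    -- Reverse triangle inequality: `|·|` is 1-Lipschitz.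
    exact div_le_one_of_le₀ (abs_abs_sub_abs_le_abs_sub _ _) (abs_nonneg _)

end Abs

/-- The Schur norm of the Loewner matrix of `|·|` is at most `1 + √(2 |T|)` if `T` contains all
indices of positive points, or all indices of nonpositive points. -/
theorem schurMultiplierNorm_loewnerMatrix_abs_le {n : ℕ} (b : Fin n → ℝ) (T : Finset (Fin n))
    (hT : (∀ i, 0 < b i → i ∈ T) ∨ ∀ i, b i ≤ 0 → i ∈ T) :
    schurMultiplierNorm (loewnerMatrix (fun x : ℝ => |x|) b) ≤ 1 + √(2 * T.card) := by
  -- Giving 0 the sign -1 matches the left derivative of `|·|` at 0.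
  refine schurMultiplierNorm_le_one_add_sqrt _ (fun i => if 0 < b i then 1 else -1) T
    (fun i => by split_ifs <;> simp) (fun i j => ?_) fun i j hi hj => ?_
  · by_cases hi : 0 < b i <;> by_cases hj : 0 < b j <;> simp only [hi, hj, if_true, if_false]
    · simp [loewnerMatrix_abs_of_pos hi hj]
    · simpa using norm_loewnerMatrix_abs_le_one
    · simpa using norm_loewnerMatrix_abs_le_one
    · norm_num [loewnerMatrix_abs_of_nonpos (not_lt.1 hi) (not_lt.1 hj)]
  · rcases hT with hT | hT
    · have hi' : ¬ 0 < b i := fun h => hi (hT i h)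
      have hj' : ¬ 0 < b j := fun h => hj (hT j h)
      norm_num only [if_neg hi', if_neg hj', loewnerMatrix_abs_of_nonpos (not_lt.1 hi') (not_lt.1 hj')]
    · have hi' := not_le.1 fun h => hi (hT i h)
      have hj' := not_le.1 fun h => hj (hT j h)
      simp [hi', hj', loewnerMatrix_abs_of_pos hi' hj']

theorem schurMultiplierNorm_const {n : ℕ} (hn : 0 < n) {L : Matrix (Fin n) (Fin n) ℂ} {c : ℂ}
    (hL : ∀ i j, L i j = c) : schurMultiplierNorm L = ‖c‖ := by
  -- Makes the matrix space nontrivial, so that its identity map has norm 1.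
  have : Nonempty (Fin n) := ⟨⟨0, hn⟩⟩
  have h : LinearMap.toContinuousLinearMap (schurMultiplier L) =
      c • ContinuousLinearMap.id ℂ (Matrix (Fin n) (Fin n) ℂ) := by
    ext A i j
    simp [schurMultiplier, Matrix.hadamard_apply, hL]
  rw [schurMultiplierNorm, h, norm_smul, ContinuousLinearMap.norm_id, mul_one]

/-- There is ample slack: `2m ≤ (2 + m)²`, and `φ⁻¹ ≥ 1/2` because `φ < 2`. -/
theorem one_add_sqrt_two_mul_le {m : ℝ} (hm : 0 ≤ m) :
    1 + √(2 * m) ≤ 3 + 2 * Real.goldenRatio⁻¹ * m := by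
  have hφ : 1 / 2 ≤ Real.goldenRatio⁻¹ := by
    rw [one_div]
    exact inv_anti₀ Real.goldenRatio_pos Real.goldenRatio_lt_two.le
  have hs : √(2 * m) ≤ 2 + m := (Real.sqrt_le_left (by positivity)).2 (by nlinarith [sq_nonneg m])
  nlinarith [mul_le_mul_of_nonneg_right hφ hm]

theorem mainTheorem7 (n : ℕ) (hn : 0 < n) (B : Matrix (Fin n) (Fin n) ℂ) (hB : B.IsHermitian)
    (b : Fin n → ℝ) (σ : Equiv.Perm (Fin n)) (hb : ∀ i, b i = hB.eigenvalues (σ i))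
    (r : ℕ) (hr : r = (Finset.univ.filter fun i => 0 < hB.eigenvalues i).card) :
    (1 ≤ r → r < n →
      schurMultiplierNorm (loewnerMatrix (fun x : ℝ => |x|) b) ≤
        3 + 2 * Real.goldenRatio⁻¹ * min (r : ℝ) ((n : ℝ) - (r : ℝ))) ∧
    (r = 0 ∨ r = n →
      schurMultiplierNorm (loewnerMatrix (fun x : ℝ => |x|) b) = 1) := by
  have hr' : (Finset.univ.filter fun i => 0 < b i).card = r := by
    rw [hr]
    exact Finset.card_equiv σ fun i => by simp [hb]
  have hcompl : ((Finset.univ.filter fun i => ¬ 0 < b i).card : ℝ) = (n : ℝ) - r := by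
    have h := Finset.card_filter_add_card_filter_not (s := Finset.univ) fun i => 0 < b i
    rw [hr', Finset.card_univ, Fintype.card_fin] at h
    rw [eq_sub_iff_add_eq']
    exact_mod_cast h
  constructor
  · intro _ hrn
    rcases min_choice (r : ℝ) ((n : ℝ) - (r : ℝ)) with h | h <;> rw [h]
    · refine le_trans ?_ (one_add_sqrt_two_mul_le r.cast_nonneg)
      rw [← hr']
      exact schurMultiplierNorm_loewnerMatrix_abs_le b _ (Or.inl fun i hi => by simp [hi])
    · refine le_trans ?_ (one_add_sqrt_two_mul_le (sub_nonneg.2 (Nat.cast_le.2 hrn.le)))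
      rw [← hcompl]
      exact schurMultiplierNorm_loewnerMatrix_abs_le b _ (Or.inr fun i hi => by simp [hi])
  -- With a single sign class, `L` is constantly -1 or 1.
  · rintro (h0 | h0)
    · have hneg : ∀ i, b i ≤ 0 := by
        rw [h0, Finset.card_eq_zero, Finset.filter_eq_empty_iff] at hr'
        exact fun i => not_lt.1 (hr' (Finset.mem_univ i))
      rw [schurMultiplierNorm_const hn fun i j => loewnerMatrix_abs_of_nonpos (hneg i) (hneg j)]
      simp
    · have hpos : ∀ i, 0 < b i := by
        have h := Finset.filter_card_eq (hr'.trans (by simp [h0] : r = Finset.univ.card))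
        exact fun i => h i (Finset.mem_univ i)
      rw [schurMultiplierNorm_const hn fun i j => loewnerMatrix_abs_of_pos (hpos i) (hpos j)]
      simp
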